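/- Let $\mathbf{k}$ be a commutative unital ring, $X$ a set, $\Omega$ a nonempty set and $\lambda_\Omega=(\lambda_\omega)_{\omega\in\Omega}$ a family of elements of $\mathbf{k}$. Algebras are unital and associative. An $\Omega$-operated algebra is a $\mathbf{k}$-algebra $R$ with a family of $\mathbf{k}$-linear operators $P_\omega:R\to R$ $(\omega\in\Omega)$; it is a matching Rota-Baxter algebra of weight $\lambda_\Omega$ if $P_\alpha(x)P_\beta(y)=P_\alpha(xP_\beta(y))+P_\beta(P_\alpha(x)y)+\lambda_\beta P_\alpha(xy)$ for all $x,y\in R$ and $\alpha,\beta\in\Omega$. It is an $\Omega$-operated filtered algebra with respect to an increasing exhaustive sequence of submodules $R_0\subseteq R_1\subseteq\cdots$, $\bigcup_n R_n=R$, if $1\in R_0$, $R_pR_q\subseteq R_{p+q}$ and $P_\omega(R_p)\subseteq R_{p+1}$ for all $p,q\ge 0$, $\omega\in\Omega$. Let $\mathfrak{M}=\mathfrak{M}(X,\Omega)$ be the monoid of $\Omega$-bracketed words in $X$, so that $\mathfrak{M}$ is the free monoid on $X\sqcup\bigsqcup_{\omega}\lfloor\mathfrak{M}\rfloor_\omega$;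 then $\mathbf{k}\mathfrak{M}$ with $P_\omega(u)=\lfloor u\rfloor_\omega$ is an $\Omega$-operated algebra. The total degree of a word is the number of occurrences in it of letters of $X$ and of brackets $\lfloor\ \rfloor_\omega$, and $\mathfrak{M}_{(n)}$ is the set of words of total degree at most $n$. Let $\mathrm{Id}(S)$ be the operated ideal (two-sided ideal stable under all $P_\omega$) of $\mathbf{k}\mathfrak{M}$ generated by all elements $\lfloor x\rfloor_\alpha\lfloor y\rfloor_\beta-\lfloor x\lfloor y\rfloor_\beta\rfloor_\alpha-\lfloor\lfloor x\rfloor_\alpha y\rfloor_\beta-\lambda_\beta\lfloor xy\rfloor_\alpha$ with $x,y\in\mathfrak{M}$, $\alpha,\beta\in\Omega$. For subsets $U,V\subseteq\mathfrak{M}$ put $UV=\{uv: u\in U, v\in V\}$, write $U^r$ for the set of products of $r$ elements of $U$ (with $U^0=\{1\}$), and put $\lfloor U\rfloor_\Omega=\{\lfloor u\rfloor_\omega: u\in U,\ \omega\in\Omega\}$. Let $M(X)$ be the set of all words in the letters of $X$ and $S(X)=M(X)\setminus\{1\}$. Put $\mathfrak{X}_0=M(X)$, $\mathfrak{X}_{n+1}=\Lambda(S(X),\mathfrak{X}_n)$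 and $\mathfrak{X}_\infty=\bigcup_n\mathfrak{X}_n$, where $$\Lambda(Y,Z)=\bigcup_{r\ge1}(Y\lfloor Z\rfloor_\Omega)^r\cup\bigcup_{r\ge0}(Y\lfloor Z\rfloor_\Omega)^rY\cup\bigcup_{r\ge1}(\lfloor Z\rfloor_\Omega Y)^r\cup\bigcup_{r\ge0}(\lfloor Z\rfloor_\Omega Y)^r\lfloor Z\rfloor_\Omega\cup\{1\}.$$ Put $\mathfrak{X}_{(n)}=\mathfrak{M}_{(n)}\cap\mathfrak{X}_\infty$. Then $\mathbf{k}\mathfrak{M}=\mathbf{k}\mathfrak{X}_\infty\oplus\mathrm{Id}(S)$. Let $\varphi:\mathbf{k}\mathfrak{M}\to\mathbf{k}\mathfrak{X}_\infty$ be the projection with kernel $\mathrm{Id}(S)$, and equip $\mathbf{k}\mathfrak{X}_\infty$ with the product $u\diamond v=\varphi(uv)$, the unit $1$ and the operators $P_\omega(w)=\lfloor w\rfloor_\omega$ $(w\in\mathfrak{X}_\infty)$, that is, with the structure transported from the quotient $\mathbf{k}\mathfrak{M}/\mathrm{Id}(S)$. Then $\mathbf{k}\mathfrak{X}_\infty$,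 with the inclusion of $X$, is the free matching Rota-Baxter algebra of weight $\lambda_\Omega$ on $X$, and with the filtration $(\mathbf{k}\mathfrak{X}_{(n)})_{n\ge0}$ it is an $\Omega$-operated filtered algebra; in particular $$P_\alpha(\mathbf{k}\mathfrak{X}_{(p)})\subseteq\mathbf{k}\mathfrak{X}_{(p+1)},\qquad \mathbf{k}\mathfrak{X}_{(p)}\diamond\mathbf{k}\mathfrak{X}_{(q)}\subseteq\mathbf{k}\mathfrak{X}_{(p+q)},\qquad p,q\ge0,\ \alpha\in\Omega.$$ Moreover, $\varphi$ is a homomorphism of $\Omega$-operated algebras and preserves the filtrations: $\varphi(\mathbf{k}\mathfrak{M}_{(n)})\subseteq\mathbf{k}\mathfrak{X}_{(n)}$ for all $n\ge0$. -/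

import Mathlib

universe u v w s t

noncomputable section

open scoped Pointwise

namespace MatchingRB

/-! ### Operated algebras, matching Rota-Baxter algebras, filtrations

An `Ω`-operated algebra over `k` is a unital associative `k`-algebra `A` together with a family
`P : Ω → A →ₗ[k] A` of linear operators. -/

section General

variable {k : Type u} {Ω : Type w} [CommRing k]

/-- The matching Rota-Baxter equation of weight `lam`. -/
def IsMatchingRotaBaxter {A : Type*} [Ring A] [Algebra k A] (lam : Ω → k)
    (P : Ω → A →ₗ[k] A) : Prop :=
  ∀ (α β : Ω) (x y : A),
    P α x * P β y = P α (x * P β y) + P β (P α x * y) + lam β • P α (x * y)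

/-- `(A, P)` together with `j : X → A` is the free matching Rota-Baxter algebra of weight `lam`
on the set `X`. -/
def IsFreeMatchingRotaBaxter {X : Type v} {A : Type s} [Ring A] [Algebra k A] (lam : Ω → k)
    (P : Ω → A →ₗ[k] A) (j : X → A) : Prop :=
  IsMatchingRotaBaxter lam P ∧
  ∀ (B : Type t) [Ring B] [Algebra k B] (Q : Ω → B →ₗ[k] B), IsMatchingRotaBaxter lam Q →
    ∀ f : X → B, ∃! g : A →ₐ[k] B, (∀ ω a, g (P ω a) = Q ω (g a)) ∧ ∀ x, g (j x) = f x

/-- An operated ideal: a two-sided ideal that is stable under all the operators. -/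
structure IsOperatedIdeal {A : Type*} [Ring A] [Algebra k A]
    (P : Ω → A →ₗ[k] A) (I : Submodule k A) : Prop where
  mul_left : ∀ a, ∀ x ∈ I, a * x ∈ I
  mul_right : ∀ a, ∀ x ∈ I, x * a ∈ I
  map_op : ∀ ω, ∀ x ∈ I, P ω x ∈ I

/-- The operated ideal generated by a subset. -/
def operatedIdealSpan {A : Type*} [Ring A] [Algebra k A]
    (P : Ω → A →ₗ[k] A) (S : Set A) : Submodule k A :=
  sInf {I | IsOperatedIdeal P I ∧ S ⊆ I}

theorem isOperatedIdeal_operatedIdealSpan {A : Type*} [Ring A] [Algebra k A]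
    (P : Ω → A →ₗ[k] A) (S : Set A) : IsOperatedIdeal P (operatedIdealSpan P S) where
  mul_left a x hx := by
    simp only [operatedIdealSpan, Submodule.mem_sInf] at hx ⊢
    exact fun I hI => hI.1.mul_left a x (hx I hI)
  mul_right a x hx := by
    simp only [operatedIdealSpan, Submodule.mem_sInf] at hx ⊢
    exact fun I hI => hI.1.mul_right a x (hx I hI)
  map_op ω x hx := by
    simp only [operatedIdealSpan, Submodule.mem_sInf] at hx ⊢
    exact fun I hI => hI.1.map_op ω x (hx I hI)

/-- `(A, P)` with the increasing exhaustive filtration `F` is an `Ω`-operated filtered algebra. -/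
structure IsOperatedFilteredAlgebra {A : Type*} [Ring A] [Algebra k A]
    (P : Ω → A →ₗ[k] A) (F : ℕ → Submodule k A) : Prop where
  mono : Monotone F
  exhaustive : ∀ a : A, ∃ n, a ∈ F n
  one_mem : (1 : A) ∈ F 0
  mul_mem : ∀ p q : ℕ, ∀ a ∈ F p, ∀ b ∈ F q, a * b ∈ F (p + q)
  op_mem : ∀ (ω : Ω) (p : ℕ), ∀ a ∈ F p, P ω a ∈ F (p + 1)

end General

/-! ### Bracketed words -/

/-- The set `𝔐(X, Ω)` of `Ω`-bracketed words in `X`, i.e. the solution of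
`𝔐(X, Ω) = M(X ⊔ ⨆_ω ⌊𝔐(X, Ω)⌋_ω)`, `M` denoting the free monoid: a bracketed word is empty, or a
letter `x ∈ X` followed by a bracketed word, or a bracket `⌊u⌋_ω` followed by a bracketed word. -/
inductive Word (X : Type v) (Ω : Type w) : Type (max v w)
  | nil : Word X Ω
  | consVar (x : X) (tail : Word X Ω) : Word X Ω
  | consBracket (ω : Ω) (u : Word X Ω) (tail : Word X Ω) : Word X Ω

namespace Word

variable {X : Type v} {Ω : Type w}

/-- Concatenation. -/
def append : Word X Ω → Word X Ω → Word X Ω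
  | nil, b => b
  | consVar x a, b => consVar x (append a b)
  | consBracket ω u a, b => consBracket ω u (append a b)

instance : Monoid (Word X Ω) where
  one := nil
  mul := append
  one_mul _ := rfl
  mul_one a := by
    change append a nil = a
    induction a with
    | nil => rfl
    | consVar x a ih => simp [append, ih]
    | consBracket ω u a _ ih => simp [append, ih]
  mul_assoc a b c := by
    change append (append a b) c = append a (append b c)
    induction a with
    | nil => rfl
    | consVar x a ih => simp [append, ih]
    | consBracket ω u a _ ih => simp [append, ih]

/-- The letter `x` as a word. -/
def var (x : X) : Word X Ω := consVar x nil

/-- The word `⌊u⌋_ω`. -/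
def bracket (ω : Ω) (u : Word X Ω) : Word X Ω := consBracket ω u nil

/-- The total degree: the number of occurrences of letters and of brackets. -/
def totalDegree : Word X Ω → ℕ
  | nil => 0
  | consVar _ a => 1 + totalDegree a
  | consBracket _ u a => 1 + totalDegree u + totalDegree a

/-- `⌊U⌋_Ω = {⌊u⌋_ω | u ∈ U, ω ∈ Ω}`. -/
def brackets (U : Set (Word X Ω)) : Set (Word X Ω) :=
  {w | ∃ ω : Ω, ∃ u ∈ U, w = bracket ω u}

/-- The alternating products `Λ(Y, Z)`. -/
def alternating (Y Z : Set (Word X Ω)) : Set (Word X Ω) :=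
  (⋃ r ≥ 1, (Y * brackets Z) ^ r) ∪ (⋃ r : ℕ, (Y * brackets Z) ^ r * Y) ∪
    (⋃ r ≥ 1, (brackets Z * Y) ^ r) ∪ (⋃ r : ℕ, (brackets Z * Y) ^ r * brackets Z) ∪ {1}

/-- The matching Rota-Baxter words of depth at most `n`: `𝔛_0 = M(X)` and
`𝔛_{n+1} = Λ(S(X), 𝔛_n)`, where `M(X)` and `S(X)` are the submonoid and the subsemigroup
generated by the letters. -/
def rbWordsUpTo (X : Type v) (Ω : Type w) : ℕ → Set (Word X Ω)
  | 0 => (Submonoid.closure (Set.range var) : Submonoid (Word X Ω))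
  | n + 1 => alternating (Subsemigroup.closure (Set.range var) : Subsemigroup (Word X Ω))
      (rbWordsUpTo X Ω n)

/-- The set `𝔛_∞` of matching Rota-Baxter words. -/
def rbWords (X : Type v) (Ω : Type w) : Set (Word X Ω) := ⋃ n, rbWordsUpTo X Ω n

/-- `𝔐_(n)`: the bracketed words of total degree at most `n`. -/
def wordsOfDegreeLE (X : Type v) (Ω : Type w) (n : ℕ) : Set (Word X Ω) :=
  {w | w.totalDegree ≤ n}

theorem one_mem_rbWords : (1 : Word X Ω) ∈ rbWords X Ω :=
  Set.mem_iUnion.2 ⟨0, Submonoid.one_mem _⟩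

theorem var_mem_rbWords (x : X) : (var x : Word X Ω) ∈ rbWords X Ω :=
  Set.mem_iUnion.2 ⟨0, Submonoid.subset_closure ⟨x, rfl⟩⟩

theorem bracket_mem_rbWords (ω : Ω) {u : Word X Ω} (hu : u ∈ rbWords X Ω) :
    bracket ω u ∈ rbWords X Ω := by
  obtain ⟨n, hn⟩ := Set.mem_iUnion.1 hu
  refine Set.mem_iUnion.2 ⟨n + 1, Or.inl (Or.inr (Set.mem_iUnion.2 ⟨0, ?_⟩))⟩
  rw [pow_zero, one_mul]
  exact ⟨ω, u, hn, rfl⟩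

end Word

/-! ### The free operated algebra and its quotient -/

variable (k : Type u) (X : Type v) {Ω : Type w} [CommRing k]

/-- The operator `P_ω` on `k𝔐(X, Ω)`: the linear extension of `u ↦ ⌊u⌋_ω`. -/
def bracketOp (ω : Ω) : MonoidAlgebra k (Word X Ω) →ₗ[k] MonoidAlgebra k (Word X Ω) :=
  MonoidAlgebra.mapDomainLinearMap k k (Word.bracket ω)

/-- The set `S` of matching Rota-Baxter relations, with `x` and `y` bracketed words. -/
def rbRelations (lam : Ω → k) : Set (MonoidAlgebra k (Word X Ω)) :=
  {s | ∃ (α β : Ω) (x y : Word X Ω),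
    s = MonoidAlgebra.of k _ (Word.bracket α x * Word.bracket β y)
      - MonoidAlgebra.of k _ (Word.bracket α (x * Word.bracket β y))
      - MonoidAlgebra.of k _ (Word.bracket β (Word.bracket α x * y))
      - lam β • MonoidAlgebra.of k _ (Word.bracket α (x * y))}

/-- `Id(S)`: the operated ideal of `k𝔐(X, Ω)` generated by `S`. -/
def rbIdeal (lam : Ω → k) : Submodule k (MonoidAlgebra k (Word X Ω)) :=
  operatedIdealSpan (bracketOp k X) (rbRelations k X lam)

variable (Ω) in
/-- `k𝔛_∞`: the linear combinations of matching Rota-Baxter words. -/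
def rbSpan : Submodule k (MonoidAlgebra k (Word X Ω)) :=
  MonoidAlgebra.supported k k (Word.rbWords X Ω)

theorem single_mem_rbSpan {a : Word X Ω} (ha : a ∈ Word.rbWords X Ω) (c : k) :
    MonoidAlgebra.single a c ∈ rbSpan k X Ω := by
  classical
  rw [rbSpan, MonoidAlgebra.mem_supported']
  intro m hm
  rw [MonoidAlgebra.coeff_single]
  exact Finsupp.single_eq_of_ne (fun h => hm (h ▸ ha))

theorem bracketOp_mem_rbSpan (ω : Ω) :
    ∀ a ∈ rbSpan k X Ω, bracketOp k X ω a ∈ rbSpan k X Ω := by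
  intro a ha
  rw [rbSpan, MonoidAlgebra.supported_eq_span_single] at ha
  induction ha using Submodule.span_induction with
  | mem y hy =>
    obtain ⟨m, hm, rfl⟩ := hy
    simp only [bracketOp, MonoidAlgebra.mapDomainLinearMap_single]
    exact single_mem_rbSpan k X (Word.bracket_mem_rbWords ω hm) 1
  | zero => simp
  | add y z _ _ hy hz => rw [map_add]; exact Submodule.add_mem _ hy hz
  | smul c y _ hy => rw [map_smul]; exact Submodule.smul_mem _ c hy

variable {k X}

/-- The underlying module `k𝔛_∞` of the free matching Rota-Baxter algebra. It carries the algebra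
structure of `k𝔐(X, Ω) / Id(S)`, transported along the decomposition
`k𝔐(X, Ω) = k𝔛_∞ ⊕ Id(S)`, which is the parameter `hc`. -/
def FreeMRB {lam : Ω → k} (_hc : IsCompl (rbSpan k X Ω) (rbIdeal k X lam)) : Type (max u v w) :=
  rbSpan k X Ω

namespace FreeMRB

variable {lam : Ω → k} (hc : IsCompl (rbSpan k X Ω) (rbIdeal k X lam))

instance : AddCommGroup (FreeMRB hc) := inferInstanceAs (AddCommGroup (rbSpan k X Ω))

instance : Module k (FreeMRB hc) := inferInstanceAs (Module k (rbSpan k X Ω))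

/-- The inclusion of `k𝔛_∞` into `k𝔐(X, Ω)`. -/
def incl : FreeMRB hc →ₗ[k] MonoidAlgebra k (Word X Ω) := (rbSpan k X Ω).subtype

/-- The projection `φ : k𝔐(X, Ω) → k𝔛_∞` with kernel `Id(S)`. -/
def proj : MonoidAlgebra k (Word X Ω) →ₗ[k] FreeMRB hc :=
  (rbSpan k X Ω).projectionOnto (rbIdeal k X lam) hc

theorem proj_incl (a : FreeMRB hc) : proj hc (incl hc a) = a :=
  Submodule.projectionOnto_apply_left hc a

theorem proj_eq_zero_iff {a : MonoidAlgebra k (Word X Ω)} :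
    proj hc a = 0 ↔ a ∈ rbIdeal k X lam :=
  Submodule.projectionOnto_apply_eq_zero_iff hc

theorem incl_proj_sub_mem (a : MonoidAlgebra k (Word X Ω)) :
    incl hc (proj hc a) - a ∈ rbIdeal k X lam := by
  rw [← proj_eq_zero_iff hc, map_sub, proj_incl, sub_self]

theorem proj_mul_left (a b : MonoidAlgebra k (Word X Ω)) :
    proj hc (incl hc (proj hc a) * b) = proj hc (a * b) := by
  rw [← sub_eq_zero, ← map_sub, ← sub_mul, proj_eq_zero_iff]
  exact (isOperatedIdeal_operatedIdealSpan _ _).mul_right _ _ (incl_proj_sub_mem hc a)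

theorem proj_mul_right (a b : MonoidAlgebra k (Word X Ω)) :
    proj hc (a * incl hc (proj hc b)) = proj hc (a * b) := by
  rw [← sub_eq_zero, ← map_sub, ← mul_sub, proj_eq_zero_iff]
  exact (isOperatedIdeal_operatedIdealSpan _ _).mul_left _ _ (incl_proj_sub_mem hc b)

/-- The product `a ⋄ b = φ(ab)`. -/
instance : Mul (FreeMRB hc) := ⟨fun a b => proj hc (incl hc a * incl hc b)⟩

/-- The unit is the empty word. -/
instance : One (FreeMRB hc) := ⟨⟨1, single_mem_rbSpan k X Word.one_mem_rbWords 1⟩⟩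

theorem mul_def (a b : FreeMRB hc) : a * b = proj hc (incl hc a * incl hc b) := rfl

theorem incl_one : incl hc 1 = 1 := rfl

instance : Ring (FreeMRB hc) :=
  { (inferInstance : AddCommGroup (FreeMRB hc)), (inferInstance : Mul (FreeMRB hc)),
    (inferInstance : One (FreeMRB hc)) with
    left_distrib := fun a b c => by simp only [mul_def, map_add, mul_add]
    right_distrib := fun a b c => by simp only [mul_def, map_add, add_mul]
    zero_mul := fun a => by simp only [mul_def, map_zero, zero_mul]
    mul_zero := fun a => by simp only [mul_def, map_zero, mul_zero]
    mul_assoc := fun a b c => by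
      simp only [mul_def, proj_mul_left, proj_mul_right, mul_assoc]
    one_mul := fun a => by simp only [mul_def, incl_one, one_mul, proj_incl]
    mul_one := fun a => by simp only [mul_def, incl_one, mul_one, proj_incl] }

instance : Algebra k (FreeMRB hc) :=
  Algebra.ofModule
    (fun c a b => by simp only [mul_def, map_smul, smul_mul_assoc])
    (fun c a b => by simp only [mul_def, map_smul, mul_smul_comm])

/-- The operator `P_ω` on `k𝔛_∞`: the linear extension of `u ↦ ⌊u⌋_ω`, `u ∈ 𝔛_∞`. -/
def op (ω : Ω) : FreeMRB hc →ₗ[k] FreeMRB hc :=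
  (bracketOp k X ω).restrict (bracketOp_mem_rbSpan k X ω)

/-- The embedding of `X`. -/
def ofVar (x : X) : FreeMRB hc :=
  ⟨MonoidAlgebra.of k _ (Word.var x), single_mem_rbSpan k X (Word.var_mem_rbWords x) 1⟩

/-- The projection `φ`, as a homomorphism of algebras. -/
def phi : MonoidAlgebra k (Word X Ω) →ₐ[k] FreeMRB hc :=
  AlgHom.ofLinearMap (proj hc) (proj_incl hc 1)
    (fun a b => by rw [mul_def, proj_mul_left, proj_mul_right])

/-- The filtration `k𝔛_(n)` of `k𝔛_∞`, where `𝔛_(n) = 𝔐_(n) ∩ 𝔛_∞`. -/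
def filtration (n : ℕ) : Submodule k (FreeMRB hc) :=
  (MonoidAlgebra.supported k k (Word.wordsOfDegreeLE X Ω n ∩ Word.rbWords X Ω)).comap (incl hc)

end FreeMRB

end MatchingRB

end

/-! Everything is read off from an explicit normal form. The words of 𝔛_∞ are exactly the bracketed
words without two adjacent brackets (`Word.mem_rbWords_iff`). Two such words multiply by
concatenation unless brackets meet at the junction; there the Rota-Baxter equation, read from left
to right, serves as a recursive definition of the product (`star`, extended bilinearly to `mulL`).
The recursion ends because every product on the right has smaller total degree.

The crux is associativity. It is easy as soon as a letter separates the factors, so what remains is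
the overlap ⌊p⌋⌊q⌋⌊r⌋, where expanding both sides reduces the claim to seven smaller instances
(`mulL_assoc_bracketTailOp`, `mulL_assoc_single`).

Evaluating bracketed words with this product gives `normalFormL`, which is multiplicative and
commutes with brackets. Its kernel is therefore an operated ideal, and it contains the relations,
hence Id(S). Conversely, every clause of `star` changes a word only modulo Id(S), so an element and
its normal form are congruent. Since Rota-Baxter words are fixed, `normalFormL` is a projection onto
k𝔛_∞ with kernel Id(S), that is, φ (`FreeMRB.incl_proj`).

No term on the right of the Rota-Baxter equation has larger total degree than the left side, so the
product and φ respect the filtrations. Freeness holds because k𝔐 is the free operated algebra and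
homomorphisms of operated algebras into matching Rota-Baxter algebras kill Id(S). -/

noncomputable section

open scoped Pointwise

namespace MatchingRB

/-! ### The recursive product and its associativity at letters and overlaps. -/

section Star

variable {k : Type u} {X : Type v} {Ω : Type w} [CommRing k]

/-- Prepending the letter `x`, extended linearly. -/
def consVarOp (x : X) : MonoidAlgebra k (Word X Ω) →ₗ[k] MonoidAlgebra k (Word X Ω) :=
  MonoidAlgebra.mapDomainLinearMap k k (Word.consVar x)

/-- Prepending the bracket `⌊p⌋_α`, extended linearly. -/
def consBracketOp (α : Ω) (p : Word X Ω) :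
    MonoidAlgebra k (Word X Ω) →ₗ[k] MonoidAlgebra k (Word X Ω) :=
  MonoidAlgebra.mapDomainLinearMap k k (Word.consBracket α p)

/-- The linear extension of `r ↦ ⌊r⌋_α v`. -/
def bracketTailOp (α : Ω) (v : Word X Ω) :
    MonoidAlgebra k (Word X Ω) →ₗ[k] MonoidAlgebra k (Word X Ω) :=
  MonoidAlgebra.mapDomainLinearMap k k (fun r => Word.consBracket α r v)

@[simp] theorem consVarOp_single (x : X) (a : Word X Ω) (c : k) :
    consVarOp x (MonoidAlgebra.single a c) = MonoidAlgebra.single (Word.consVar x a) c :=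
  MonoidAlgebra.mapDomainLinearMap_single _ _ _

@[simp] theorem consBracketOp_single (α : Ω) (p a : Word X Ω) (c : k) :
    consBracketOp α p (MonoidAlgebra.single a c) =
      MonoidAlgebra.single (Word.consBracket α p a) c :=
  MonoidAlgebra.mapDomainLinearMap_single _ _ _

@[simp] theorem bracketTailOp_single (α : Ω) (v a : Word X Ω) (c : k) :
    bracketTailOp α v (MonoidAlgebra.single a c) =
      MonoidAlgebra.single (Word.consBracket α a v) c :=
  MonoidAlgebra.mapDomainLinearMap_single _ _ _

@[simp] theorem bracketOp_single (α : Ω) (a : Word X Ω) (c : k) :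
    bracketOp k X α (MonoidAlgebra.single a c) =
      MonoidAlgebra.single (Word.consBracket α a Word.nil) c :=
  MonoidAlgebra.mapDomainLinearMap_single _ _ _

/-- The product of two words in normal form. -/
def star (lam : Ω → k) : Word X Ω → Word X Ω → MonoidAlgebra k (Word X Ω)
  | .nil, b => MonoidAlgebra.single b 1
  | .consVar x a, b => consVarOp x (star lam a b)
  | .consBracket α p (.consVar x a), b => consBracketOp α p (consVarOp x (star lam a b))
  | .consBracket α p (.consBracket β q a), b =>
      consBracketOp α p (star lam (.consBracket β q a) b)
  | .consBracket α p .nil, .nil => MonoidAlgebra.single (.consBracket α p .nil) 1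
  | .consBracket α p .nil, .consVar x b =>
      MonoidAlgebra.single (.consBracket α p (.consVar x b)) 1
  -- The tail `b` stays outside the recursion. For Rota-Baxter factors it is empty or starts with a
  -- letter, so it can follow any single bracket.
  | .consBracket α p .nil, .consBracket β q b =>
      bracketTailOp α b (star lam p (.consBracket β q .nil)) +
        bracketTailOp β b (star lam (.consBracket α p .nil) q) +
        lam β • bracketTailOp α b (star lam p q)
termination_by a b => a.totalDegree + b.totalDegree
decreasing_by all_goals simp only [Word.totalDegree]; omega

/-- The bilinear extension of `star`. -/
def mulL (lam : Ω → k) : MonoidAlgebra k (Word X Ω) →ₗ[k] MonoidAlgebra k (Word X Ω) →ₗ[k]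
    MonoidAlgebra k (Word X Ω) :=
  (MonoidAlgebra.basis (Word X Ω) k).constr k fun a =>
    (MonoidAlgebra.basis (Word X Ω) k).constr k fun b => star lam a b

theorem mulL_single (lam : Ω → k) (a b : Word X Ω) :
    mulL lam (MonoidAlgebra.single a 1) (MonoidAlgebra.single b 1) = star lam a b := by
  rw [mulL, ← MonoidAlgebra.basis_apply, Module.Basis.constr_basis, ← MonoidAlgebra.basis_apply,
    Module.Basis.constr_basis]

theorem linearMap_ext {N : Type*} [AddCommMonoid N] [Module k N]
    {f g : MonoidAlgebra k (Word X Ω) →ₗ[k] N}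
    (h : ∀ a, f (MonoidAlgebra.single a 1) = g (MonoidAlgebra.single a 1)) : f = g :=
  (MonoidAlgebra.basis (Word X Ω) k).ext fun a => by
    simpa only [MonoidAlgebra.basis_apply] using h a

variable (lam : Ω → k)

theorem mulL_nil_left (b : MonoidAlgebra k (Word X Ω)) :
    mulL lam (MonoidAlgebra.single Word.nil 1) b = b := by
  suffices h : mulL lam (MonoidAlgebra.single Word.nil 1) = LinearMap.id by rw [h]; rfl
  exact linearMap_ext fun b => by rw [mulL_single, star]; rfl

theorem star_nil_right (a : Word X Ω) : star lam a Word.nil = MonoidAlgebra.single a 1 := by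
  induction a with
  | nil => rw [star]
  | consVar x a ih => rw [star, ih, consVarOp_single]
  | consBracket α p a _ ih =>
    cases a with
    | nil => rw [star]
    | consVar x a =>
      -- The clause for a bracket followed by a letter strips both at once, so the induction
      -- hypothesis has to be unfolded by one letter.
      rw [star] at ih; rw [star]
      rw [ih, consBracketOp_single]
    | consBracket β q a => rw [star, ih, consBracketOp_single]

theorem mulL_nil_right (a : MonoidAlgebra k (Word X Ω)) :
    mulL lam a (MonoidAlgebra.single Word.nil 1) = a := by
  suffices h : (mulL lam).flip (MonoidAlgebra.single Word.nil 1) = LinearMap.id by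
    exact LinearMap.congr_fun h a
  exact linearMap_ext fun b => by
    rw [LinearMap.flip_apply, mulL_single, star_nil_right]; rfl

theorem mulL_consVarOp (x : X) (a b : MonoidAlgebra k (Word X Ω)) :
    mulL lam (consVarOp x a) b = consVarOp x (mulL lam a b) := by
  suffices h : mulL lam ∘ₗ consVarOp x = (consVarOp x).compRight k ∘ₗ mulL lam by
    exact LinearMap.congr_fun (LinearMap.congr_fun h a) b
  refine linearMap_ext fun a => linearMap_ext fun b => ?_
  simp only [LinearMap.comp_apply, LinearMap.compRight_apply, consVarOp_single, mulL_single]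
  rw [star]

theorem mulL_bracketOp_consVar (α : Ω) (x : X) (v : Word X Ω) (p : MonoidAlgebra k (Word X Ω)) :
    mulL lam (bracketOp k X α p) (MonoidAlgebra.single (Word.consVar x v) 1) =
      bracketTailOp α (Word.consVar x v) p := by
  suffices h : (mulL lam).flip (MonoidAlgebra.single (Word.consVar x v) 1) ∘ₗ bracketOp k X α =
      bracketTailOp α (Word.consVar x v) by exact LinearMap.congr_fun h p
  refine linearMap_ext fun p => ?_
  simp only [LinearMap.comp_apply, LinearMap.flip_apply, bracketOp_single, mulL_single,
    bracketTailOp_single]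
  rw [star]

/-- Multiplying two words whose junction is a pair of brackets. -/
theorem mulL_bracketOp_bracketTailOp (α β : Ω) (v : Word X Ω)
    (p q : MonoidAlgebra k (Word X Ω)) :
    mulL lam (bracketOp k X α p) (bracketTailOp β v q) =
      bracketTailOp α v (mulL lam p (bracketOp k X β q)) +
        bracketTailOp β v (mulL lam (bracketOp k X α p) q) +
        lam β • bracketTailOp α v (mulL lam p q) := by
  suffices h : (mulL lam).compl₁₂ (bracketOp k X α) (bracketTailOp β v) =
      ((mulL lam).compl₁₂ LinearMap.id (bracketOp k X β)).compr₂ (bracketTailOp α v) +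
      ((mulL lam).compl₁₂ (bracketOp k X α) LinearMap.id).compr₂ (bracketTailOp β v) +
      lam β • (mulL lam).compr₂ (bracketTailOp α v) by
    exact LinearMap.congr_fun (LinearMap.congr_fun h p) q
  refine linearMap_ext fun p => linearMap_ext fun q => ?_
  simp only [LinearMap.compl₁₂_apply, LinearMap.add_apply, LinearMap.smul_apply,
    LinearMap.compr₂_apply, LinearMap.id_apply, bracketOp_single, bracketTailOp_single,
    mulL_single]
  rw [star]

/-- The empty tail turns the junction formula into the matching Rota-Baxter equation for `mulL`,
valid on all of k𝔐. -/
theorem mulL_bracketOp_bracketOp (α β : Ω) (p q : MonoidAlgebra k (Word X Ω)) :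
    mulL lam (bracketOp k X α p) (bracketOp k X β q) =
      bracketOp k X α (mulL lam p (bracketOp k X β q)) +
        bracketOp k X β (mulL lam (bracketOp k X α p) q) +
        lam β • bracketOp k X α (mulL lam p q) :=
  mulL_bracketOp_bracketTailOp lam α β Word.nil p q

/-- A letter behind the first bracket shields it: the right factor only interacts with what follows
the letter. -/
theorem mulL_bracketTailOp_consVar (α : Ω) (x : X) (v : Word X Ω)
    (p b : MonoidAlgebra k (Word X Ω)) :
    mulL lam (bracketTailOp α (Word.consVar x v) p) b =
      mulL lam (bracketOp k X α p) (consVarOp x (mulL lam (MonoidAlgebra.single v 1) b)) := by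
  suffices h : mulL lam ∘ₗ bracketTailOp α (Word.consVar x v) =
      (mulL lam).compl₁₂ (bracketOp k X α)
        (consVarOp x ∘ₗ mulL lam (MonoidAlgebra.single v 1)) by
    exact LinearMap.congr_fun (LinearMap.congr_fun h p) b
  refine linearMap_ext fun p => linearMap_ext fun b => ?_
  simp only [LinearMap.comp_apply, LinearMap.compl₁₂_apply, bracketTailOp_single, bracketOp_single,
    mulL_single]
  rw [star]
  -- All that matters about the inner product is that a letter is put in front of it: a bracket
  -- times such an element is a concatenation.
  generalize star lam v b = c
  suffices h : consBracketOp α p ∘ₗ consVarOp x =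
      mulL lam (MonoidAlgebra.single (Word.consBracket α p Word.nil) 1) ∘ₗ consVarOp x by
    exact LinearMap.congr_fun h c
  refine linearMap_ext fun c => ?_
  simp only [LinearMap.comp_apply, consVarOp_single, consBracketOp_single, mulL_single]
  rw [star]

/-- Brackets followed by a letter multiply by concatenation, so they associate. -/
theorem mulL_assoc_consVarOp_middle (α : Ω) (x : X) (p b c : MonoidAlgebra k (Word X Ω)) :
    mulL lam (mulL lam (bracketOp k X α p) (consVarOp x b)) c =
      mulL lam (bracketOp k X α p) (mulL lam (consVarOp x b) c) := by
  suffices h : (mulL lam).flip c ∘ₗ mulL lam (bracketOp k X α p) ∘ₗ consVarOp x =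
      mulL lam (bracketOp k X α p) ∘ₗ (mulL lam).flip c ∘ₗ consVarOp x by
    exact LinearMap.congr_fun h b
  refine linearMap_ext fun b => ?_
  simp only [LinearMap.comp_apply, LinearMap.flip_apply]
  rw [consVarOp_single, mulL_bracketOp_consVar, mulL_bracketTailOp_consVar, ← consVarOp_single,
    mulL_consVarOp]

/-- Multiplying a bracket by a word that starts with a letter just attaches a tail, so both sides
are the Rota-Baxter expansion of ⌊p⌋⌊q⌋ with the same tail. -/
theorem mulL_assoc_consVarOp_right (α β : Ω) (x : X) (p q c : MonoidAlgebra k (Word X Ω)) :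
    mulL lam (mulL lam (bracketOp k X α p) (bracketOp k X β q)) (consVarOp x c) =
      mulL lam (bracketOp k X α p) (mulL lam (bracketOp k X β q) (consVarOp x c)) := by
  suffices h : mulL lam (mulL lam (bracketOp k X α p) (bracketOp k X β q)) ∘ₗ consVarOp x =
      mulL lam (bracketOp k X α p) ∘ₗ mulL lam (bracketOp k X β q) ∘ₗ consVarOp x by
    exact LinearMap.congr_fun h c
  refine linearMap_ext fun c => ?_
  simp only [LinearMap.comp_apply, consVarOp_single, mulL_bracketOp_consVar,
    mulL_bracketOp_bracketTailOp, mulL_bracketOp_bracketOp, map_add, LinearMap.add_apply, map_smul,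
    LinearMap.smul_apply]

/-- The overlap `⌊p⌋_α ⌊q⌋_β ⌊r⌋_γ`: associativity follows from smaller instances. -/
theorem mulL_assoc_bracketTailOp {α β γ : Ω} (v : Word X Ω) {p q r : MonoidAlgebra k (Word X Ω)}
    (h₁ : mulL lam (mulL lam p (bracketOp k X β q)) (bracketOp k X γ r) =
      mulL lam p (mulL lam (bracketOp k X β q) (bracketOp k X γ r)))
    (h₂ : mulL lam (mulL lam (bracketOp k X α p) q) (bracketOp k X γ r) =
      mulL lam (bracketOp k X α p) (mulL lam q (bracketOp k X γ r)))
    (h₃ : mulL lam (mulL lam p q) (bracketOp k X γ r) =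
      mulL lam p (mulL lam q (bracketOp k X γ r)))
    (h₄ : mulL lam (mulL lam (bracketOp k X α p) (bracketOp k X β q)) r =
      mulL lam (bracketOp k X α p) (mulL lam (bracketOp k X β q) r))
    (h₅ : mulL lam (mulL lam p (bracketOp k X β q)) r =
      mulL lam p (mulL lam (bracketOp k X β q) r))
    (h₆ : mulL lam (mulL lam (bracketOp k X α p) q) r =
      mulL lam (bracketOp k X α p) (mulL lam q r))
    (h₇ : mulL lam (mulL lam p q) r = mulL lam p (mulL lam q r)) :
    mulL lam (mulL lam (bracketOp k X α p) (bracketOp k X β q)) (bracketTailOp γ v r) =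
      mulL lam (bracketOp k X α p) (mulL lam (bracketOp k X β q) (bracketTailOp γ v r)) := by
  -- Expanding the left side of `h₄` gives the three contents of the outer γ-brackets produced by
  -- the left-hand product; the right-hand product has them as the single term ⌊p⌋(⌊q⌋r). The
  -- remaining hypotheses match the terms under α- and β-brackets.
  rw [mulL_bracketOp_bracketOp] at h₄
  simp only [map_add, LinearMap.add_apply, map_smul, LinearMap.smul_apply] at h₄
  simp only [mulL_bracketOp_bracketOp, mulL_bracketOp_bracketTailOp, map_add, LinearMap.add_apply,
    map_smul, LinearMap.smul_apply, h₁, h₂, h₃, h₅, h₆, h₇, smul_add, ← h₄, smul_comm (lam γ)]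
  abel

end Star

/-! ### Rota-Baxter words are the words without adjacent brackets. -/

namespace Word

variable {X : Type v} {Ω : Type w}

/-- The bracketed words that contain no two adjacent brackets. -/
inductive IsRB : Word X Ω → Prop
  | nil : IsRB nil
  | consVar (x : X) {a : Word X Ω} : IsRB a → IsRB (consVar x a)
  | bracket (ω : Ω) {u : Word X Ω} : IsRB u → IsRB (consBracket ω u nil)
  | consBracket (ω : Ω) (x : X) {u a : Word X Ω} :
      IsRB u → IsRB a → IsRB (consBracket ω u (Word.consVar x a))

/-- The words without adjacent brackets that are empty or start with a letter. -/
def IsRBVar (a : Word X Ω) : Prop := a = 1 ∨ ∃ x b, IsRB b ∧ a = consVar x b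

theorem IsRBVar.isRB {a : Word X Ω} (h : IsRBVar a) : IsRB a := by
  obtain rfl | ⟨x, b, hb, rfl⟩ := h
  · exact .nil
  · exact hb.consVar x

theorem IsRBVar.bracket_mul {a u : Word X Ω} (h : IsRBVar a) (ω : Ω) (hu : IsRB u) :
    IsRB (bracket ω u * a) := by
  obtain rfl | ⟨x, b, hb, rfl⟩ := h
  · exact hu.bracket ω
  · exact hu.consBracket ω x hb

theorem IsRB.letters_mul {y a : Word X Ω}
    (hy : y ∈ Subsemigroup.closure (Set.range (var : X → Word X Ω))) (ha : IsRB a) :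
    IsRBVar (y * a) := by
  induction hy using Subsemigroup.closure_induction generalizing a with
  | mem y hy =>
    obtain ⟨x, rfl⟩ := hy
    exact Or.inr ⟨x, a, ha, rfl⟩
  | mul y z _ _ hy hz =>
    rw [mul_assoc]
    exact hy (hz ha).isRB

theorem isRB_of_mem_closure {a : Word X Ω}
    (ha : a ∈ Submonoid.closure (Set.range (var : X → Word X Ω))) : IsRB a := by
  induction ha using Submonoid.closure_induction_left with
  | one => exact .nil
  | mul_left y hy a _ ih =>
    obtain ⟨x, rfl⟩ := hy
    exact ih.consVar x

theorem pow_mul_subset {A S : Set (Word X Ω)} (h : A * S ⊆ S) (r : ℕ) : A ^ r * S ⊆ S := by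
  induction r with
  | zero => rw [pow_zero, one_mul]
  | succ r ih =>
    rw [pow_succ, mul_assoc]
    exact (Set.mul_subset_mul_left h).trans ih

/-- Build the product from the right: letters turn any admissible word into one starting with a
letter, and a bracket may precede an admissible word that is empty or starts with a letter. -/
theorem alternating_subset_isRB {Z : Set (Word X Ω)} (hZ : ∀ u ∈ Z, IsRB u) :
    alternating (Subsemigroup.closure (Set.range var) : Subsemigroup (Word X Ω)) Z ⊆
      {a | IsRB a} := by
  set Y : Set (Word X Ω) := ↑(Subsemigroup.closure (Set.range var) : Subsemigroup (Word X Ω))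
  have hY : Y * {a | IsRB a} ⊆ {a | IsRBVar a} := by
    rintro _ ⟨y, hy, a, ha, rfl⟩
    exact IsRB.letters_mul hy ha
  have hB : brackets Z * {a | IsRBVar a} ⊆ {a | IsRB a} := by
    rintro _ ⟨_, ⟨ω, u, hu, rfl⟩, a, ha, rfl⟩
    exact ha.bracket_mul ω (hZ u hu)
  have hvar : {a : Word X Ω | IsRBVar a} ⊆ {a | IsRB a} := fun a ha => ha.isRB
  have hYB : ∀ r, (Y * brackets Z) ^ r * {a | IsRBVar a} ⊆ {a | IsRBVar a} :=
    pow_mul_subset (by rw [mul_assoc]; exact (Set.mul_subset_mul_left hB).trans hY)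
  have hBY : ∀ r, (brackets Z * Y) ^ r * {a | IsRB a} ⊆ {a | IsRB a} :=
    pow_mul_subset (by rw [mul_assoc]; exact (Set.mul_subset_mul_left hY).trans hB)
  have hone : (1 : Word X Ω) ∈ {a : Word X Ω | IsRBVar a} := Or.inl rfl
  have hY' : Y ⊆ {a | IsRBVar a} := fun y hy => hY ⟨y, hy, 1, .nil, mul_one y⟩
  have hB' : brackets Z ⊆ {a | IsRB a} := fun y hy => hB ⟨y, hy, 1, hone, mul_one y⟩
  rintro a ((((h | h) | h) | h) | h)
  · obtain ⟨r, _, h⟩ := Set.mem_iUnion₂.1 h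
    exact hvar (hYB r ⟨a, h, 1, hone, mul_one a⟩)
  · obtain ⟨r, h⟩ := Set.mem_iUnion.1 h
    exact hvar (hYB r (Set.mul_subset_mul_left hY' h))
  · obtain ⟨r, _, h⟩ := Set.mem_iUnion₂.1 h
    exact hBY r ⟨a, h, 1, .nil, mul_one a⟩
  · obtain ⟨r, h⟩ := Set.mem_iUnion.1 h
    exact hBY r (Set.mul_subset_mul_left hB' h)
  · rw [Set.mem_singleton_iff.1 h]
    exact .nil

theorem isRB_of_mem_rbWordsUpTo (n : ℕ) : ∀ a ∈ rbWordsUpTo X Ω n, IsRB a := by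
  induction n with
  | zero => exact fun a ha => isRB_of_mem_closure ha
  | succ n ih => exact alternating_subset_isRB ih

/-- The alternating products that are empty or start with a factor in `Y`. -/
def altLeft (Y B : Set (Word X Ω)) : Set (Word X Ω) :=
  (⋃ r : ℕ, (Y * B) ^ r) ∪ ⋃ r : ℕ, (Y * B) ^ r * Y

theorem one_mem_altLeft (Y B : Set (Word X Ω)) : 1 ∈ altLeft Y B :=
  Or.inl (Set.mem_iUnion.2 ⟨0, by rw [pow_zero]; exact Set.mem_one.2 rfl⟩)

/-- The regrouping (YB)^r Y = Y(BY)^r exchanges the two kinds of alternating products. -/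
theorem mul_mem_altLeft {Y B : Set (Word X Ω)} {y a : Word X Ω} (hy : y ∈ Y)
    (ha : a ∈ altLeft B Y) : y * a ∈ altLeft Y B := by
  rcases ha with h | h <;> obtain ⟨r, h⟩ := Set.mem_iUnion.1 h
  · refine Or.inr (Set.mem_iUnion.2 ⟨r, ?_⟩)
    rw [mul_pow_mul]
    exact Set.mul_mem_mul hy h
  · refine Or.inl (Set.mem_iUnion.2 ⟨r + 1, ?_⟩)
    rw [pow_succ, ← mul_assoc, mul_pow_mul, mul_assoc]
    exact Set.mul_mem_mul hy h

/-- Here the new factor is absorbed into the leading `Y`-factor, so the alternation is not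
disturbed. -/
theorem letter_mul_mem_altLeft {Y B : Set (Word X Ω)} {y a : Word X Ω} (hy : y ∈ Y)
    (hY : ∀ z ∈ Y, y * z ∈ Y) (ha : a ∈ altLeft Y B) : y * a ∈ altLeft Y B := by
  have key : ∀ c : Word X Ω, ∀ S : Set (Word X Ω), c ∈ Y * S → y * c ∈ Y * S := by
    rintro _ S ⟨z, hz, b, hb, rfl⟩
    exact ⟨y * z, hY z hz, b, hb, mul_assoc y z b⟩
  rcases ha with h | h <;> obtain ⟨r, h⟩ := Set.mem_iUnion.1 h
  · cases r with
    | zero =>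
      rw [pow_zero, Set.mem_one] at h
      rw [h]
      exact mul_mem_altLeft hy (one_mem_altLeft B Y)
    | succ r =>
      refine Or.inl (Set.mem_iUnion.2 ⟨r + 1, ?_⟩)
      rw [pow_succ', mul_assoc] at h ⊢
      exact key _ _ h
  · refine Or.inr (Set.mem_iUnion.2 ⟨r, ?_⟩)
    rw [mul_pow_mul] at h ⊢
    exact key _ _ h

theorem altLeft_subset_alternating (Y Z : Set (Word X Ω)) :
    altLeft Y (brackets Z) ⊆ alternating Y Z := by
  rintro a (h | h) <;> obtain ⟨r, h⟩ := Set.mem_iUnion.1 h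
  · cases r with
    | zero => exact Or.inr (Set.mem_one.1 (by rwa [pow_zero] at h))
    | succ r => exact Or.inl (Or.inl (Or.inl (Or.inl (Set.mem_iUnion₂.2 ⟨r + 1, by omega, h⟩))))
  · exact Or.inl (Or.inl (Or.inl (Or.inr (Set.mem_iUnion.2 ⟨r, h⟩))))

theorem altLeft_brackets_subset_alternating (Y Z : Set (Word X Ω)) :
    altLeft (brackets Z) Y ⊆ alternating Y Z := by
  rintro a (h | h) <;> obtain ⟨r, h⟩ := Set.mem_iUnion.1 h
  · cases r with
    | zero => exact Or.inr (Set.mem_one.1 (by rwa [pow_zero] at h))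
    | succ r => exact Or.inl (Or.inl (Or.inr (Set.mem_iUnion₂.2 ⟨r + 1, by omega, h⟩)))
  · exact Or.inl (Or.inr (Set.mem_iUnion.2 ⟨r, h⟩))

/-- Total degree bounds bracket depth. Quantifying over every `n` above the degree places all
bracket contents on one common level, so monotonicity of the levels 𝔛_n is not needed. -/
theorem IsRB.mem_rbWordsUpTo {a : Word X Ω} (ha : IsRB a) :
    ∀ n, a.totalDegree ≤ n → a ∈ rbWordsUpTo X Ω (n + 1) := by
  set Y : Set (Word X Ω) := ↑(Subsemigroup.closure (Set.range var) : Subsemigroup (Word X Ω))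
  have hword : ∀ u : Word X Ω, (∀ n, u.totalDegree ≤ n →
      u ∈ altLeft Y (brackets (rbWordsUpTo X Ω n)) ∪ altLeft (brackets (rbWordsUpTo X Ω n)) Y) →
      ∀ n, u.totalDegree ≤ n → u ∈ rbWordsUpTo X Ω (n + 1) :=
    fun u h n hn => (h n hn).elim (fun h => altLeft_subset_alternating _ _ h)
      (fun h => altLeft_brackets_subset_alternating _ _ h)
  have hvar : ∀ x : X, (var x : Word X Ω) ∈ Y := fun x => Subsemigroup.subset_closure ⟨x, rfl⟩
  have hcons : ∀ (x : X) (a : Word X Ω) (B : Set (Word X Ω)),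
      a ∈ altLeft Y B ∪ altLeft B Y → Word.consVar x a ∈ altLeft Y B := by
    rintro x a B (h | h)
    · exact letter_mul_mem_altLeft (hvar x) (fun z hz => Subsemigroup.mul_mem _ (hvar x) hz) h
    · exact mul_mem_altLeft (hvar x) h
  have hbr : ∀ (ω : Ω) (u : Word X Ω),
      (∀ n, u.totalDegree ≤ n → u ∈ rbWordsUpTo X Ω (n + 1)) → ∀ n, 1 + u.totalDegree ≤ n →
        Word.bracket ω u ∈ brackets (rbWordsUpTo X Ω n) := by
    intro ω u ih n hn
    -- The bracket itself accounts for one unit of degree, which pays for the shift by one level.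
    obtain ⟨m, rfl⟩ : ∃ m, n = m + 1 := ⟨n - 1, by omega⟩
    exact ⟨ω, u, ih m (by omega), rfl⟩
  refine hword a ?_
  induction ha with
  | nil => exact fun n _ => Or.inl (one_mem_altLeft _ _)
  | consVar x _ ih =>
    intro n hn
    rw [totalDegree] at hn
    exact Or.inl (hcons x _ _ (ih n (by omega)))
  | bracket ω _ ih =>
    intro n hn
    rw [totalDegree, totalDegree] at hn
    exact Or.inr (mul_mem_altLeft (hbr ω _ (hword _ ih) n (by omega)) (one_mem_altLeft _ _))
  | consBracket ω x _ _ ih₁ ih₂ =>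
    intro n hn
    rw [totalDegree, totalDegree] at hn
    exact Or.inr (mul_mem_altLeft (hbr ω _ (hword _ ih₁) n (by omega))
      (hcons x _ _ (ih₂ n (by omega))))

theorem mem_rbWords_iff {a : Word X Ω} : a ∈ rbWords X Ω ↔ IsRB a := by
  constructor
  · intro h
    obtain ⟨n, hn⟩ := Set.mem_iUnion.1 h
    exact isRB_of_mem_rbWordsUpTo n a hn
  · exact fun h => Set.mem_iUnion.2 ⟨_, h.mem_rbWordsUpTo _ le_rfl⟩

end Word

/-! ### Associativity on Rota-Baxter words, and linear extension. -/

section NormalForm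

variable {k : Type u} {X : Type v} {Ω : Type w} [CommRing k] (lam : Ω → k)

/-- Induction on the sum of the three degrees. A letter in `a` or `b`, or at the start of `c`,
reduces to the lemmas above; only three brackets in a row need the overlap computation. The word `c`
may have adjacent brackets, since its tail is merely carried along there. -/
theorem mulL_assoc_single (a b c : Word X Ω) (ha : a.IsRB) (hb : b.IsRB) :
    mulL lam (mulL lam (MonoidAlgebra.single a 1) (MonoidAlgebra.single b 1))
        (MonoidAlgebra.single c 1) =
      mulL lam (MonoidAlgebra.single a 1)
        (mulL lam (MonoidAlgebra.single b 1) (MonoidAlgebra.single c (1 : k))) := by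
  induction hn : a.totalDegree + b.totalDegree + c.totalDegree using Nat.strong_induction_on
    generalizing a b c with
  | _ n ih =>
  subst hn
  cases ha with
  | nil => rw [mulL_nil_left, mulL_nil_left]
  | @consVar x a ha =>
    have h := ih _ (by rw [Word.totalDegree]; omega) a b c ha hb rfl
    rw [← consVarOp_single, mulL_consVarOp, mulL_consVarOp, mulL_consVarOp, h]
  | @consBracket α x p a hp ha =>
    have h := ih _ (by rw [Word.totalDegree, Word.totalDegree]; omega) a b c ha hb rfl
    rw [← bracketTailOp_single, mulL_bracketTailOp_consVar, mulL_bracketTailOp_consVar,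
      mulL_assoc_consVarOp_middle, mulL_consVarOp, h]
  | @bracket α p hp =>
    rw [← bracketOp_single]
    cases hb with
    | nil => rw [mulL_nil_right, mulL_nil_left]
    | consVar x hb => rw [← consVarOp_single, mulL_assoc_consVarOp_middle]
    | @consBracket β x q b hq hb =>
      have h : ∀ r : MonoidAlgebra k (Word X Ω), ∀ δ : Ω,
          mulL lam (bracketTailOp δ (Word.consVar x b) r) (MonoidAlgebra.single c 1) =
            mulL lam (bracketOp k X δ r)
              (consVarOp x (mulL lam (MonoidAlgebra.single b 1) (MonoidAlgebra.single c 1))) :=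
        fun r δ => mulL_bracketTailOp_consVar lam δ x b r _
      rw [← bracketTailOp_single, h, ← mulL_assoc_consVarOp_right, mulL_bracketOp_bracketOp,
        mulL_bracketOp_bracketTailOp]
      simp only [map_add, LinearMap.add_apply, map_smul, LinearMap.smul_apply, h]
    | @bracket β q hq =>
      rw [← bracketOp_single]
      cases c with
      | nil => rw [mulL_nil_right, mulL_nil_right]
      | consVar x c => rw [← consVarOp_single, mulL_assoc_consVarOp_right]
      | consBracket γ r c =>
        rw [← bracketTailOp_single]
        have key := fun a b c ha hb h => ih _ h a b c ha hb rfl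
        simp only [Word.totalDegree] at key
        -- Each of the seven instances removes at least one of the three outer brackets, so it has
        -- smaller degree, and its first two factors still have no adjacent brackets.
        apply mulL_assoc_bracketTailOp <;> (try simp only [bracketOp_single]) <;> apply key <;>
          first
          | assumption
          | exact Word.IsRB.bracket _ (by assumption)
          | ((try simp only [Word.totalDegree]); omega)

/-- A linear map that sends the words in `s` into `N` sends the elements supported on `s`
into `N`. -/
theorem mem_of_mem_supported {V : Type*} [AddCommGroup V] [Module k V] {s : Set (Word X Ω)}
    (f : MonoidAlgebra k (Word X Ω) →ₗ[k] V) (N : Submodule k V)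
    (h : ∀ a ∈ s, f (MonoidAlgebra.single a 1) ∈ N) {x : MonoidAlgebra k (Word X Ω)}
    (hx : x ∈ MonoidAlgebra.supported k k s) : f x ∈ N := by
  rw [MonoidAlgebra.supported_eq_span_single] at hx
  suffices h' : Submodule.span k ((MonoidAlgebra.single · (1 : k)) '' s) ≤ N.comap f from h' hx
  rw [Submodule.span_le]
  rintro _ ⟨a, ha, rfl⟩
  exact h a ha

theorem mem_of_forall_single {V : Type*} [AddCommGroup V] [Module k V]
    (f : MonoidAlgebra k (Word X Ω) →ₗ[k] V) (N : Submodule k V)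
    (h : ∀ a, f (MonoidAlgebra.single a 1) ∈ N) (x : MonoidAlgebra k (Word X Ω)) : f x ∈ N := by
  suffices h' : N.mkQ ∘ₗ f = 0 by
    have := LinearMap.congr_fun h' x
    rwa [LinearMap.comp_apply, LinearMap.zero_apply, Submodule.mkQ_apply,
      Submodule.Quotient.mk_eq_zero] at this
  refine linearMap_ext fun a => ?_
  rw [LinearMap.comp_apply, LinearMap.zero_apply, Submodule.mkQ_apply,
    Submodule.Quotient.mk_eq_zero]
  exact h a

theorem single_mem_supported {s : Set (Word X Ω)} {a : Word X Ω} (ha : a ∈ s) :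
    MonoidAlgebra.single a (1 : k) ∈ MonoidAlgebra.supported k k s := by
  rw [MonoidAlgebra.supported_eq_span_single]
  exact Submodule.subset_span ⟨a, ha, rfl⟩

/-! ### The product and the degree filtration. -/

variable (k X Ω) in
/-- `k𝔛_(n)`, as a submodule of `k𝔐`. -/
def rbDegreeLE (n : ℕ) : Submodule k (MonoidAlgebra k (Word X Ω)) :=
  MonoidAlgebra.supported k k (Word.wordsOfDegreeLE X Ω n ∩ Word.rbWords X Ω)

theorem single_mem_rbDegreeLE {a : Word X Ω} {n : ℕ} (ha : a.IsRB) (hn : a.totalDegree ≤ n) :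
    MonoidAlgebra.single a (1 : k) ∈ rbDegreeLE k X Ω n :=
  single_mem_supported ⟨hn, Word.mem_rbWords_iff.2 ha⟩

theorem map_mem_of_mem_rbDegreeLE {V : Type*} [AddCommGroup V] [Module k V] {n : ℕ}
    (f : MonoidAlgebra k (Word X Ω) →ₗ[k] V) (N : Submodule k V)
    (h : ∀ a : Word X Ω, a.IsRB → a.totalDegree ≤ n → f (MonoidAlgebra.single a 1) ∈ N)
    {x : MonoidAlgebra k (Word X Ω)} (hx : x ∈ rbDegreeLE k X Ω n) : f x ∈ N :=
  mem_of_mem_supported f N (fun a ha => h a (Word.mem_rbWords_iff.1 ha.2) ha.1) hx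

theorem rbDegreeLE_mono : Monotone (rbDegreeLE k X Ω) := fun _ _ hmn _ hx =>
  map_mem_of_mem_rbDegreeLE LinearMap.id _
    (fun _ ha hn => single_mem_rbDegreeLE ha (hn.trans hmn)) hx

theorem rbDegreeLE_le_rbSpan (n : ℕ) : rbDegreeLE k X Ω n ≤ rbSpan k X Ω := fun _ hx =>
  map_mem_of_mem_rbDegreeLE LinearMap.id _
    (fun _ ha _ => single_mem_rbSpan k X (Word.mem_rbWords_iff.2 ha) 1) hx

theorem consVarOp_mem_rbDegreeLE (x : X) {n : ℕ} {a : MonoidAlgebra k (Word X Ω)}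
    (ha : a ∈ rbDegreeLE k X Ω n) : consVarOp x a ∈ rbDegreeLE k X Ω (1 + n) :=
  map_mem_of_mem_rbDegreeLE _ _ (fun a ha hn => by
    rw [consVarOp_single]
    exact single_mem_rbDegreeLE (ha.consVar x) (by rw [Word.totalDegree]; omega)) ha

theorem bracketTailOp_mem_rbDegreeLE (α : Ω) {v : Word X Ω}
    (hv : ∀ r : Word X Ω, r.IsRB → (Word.consBracket α r v).IsRB) {n : ℕ}
    {a : MonoidAlgebra k (Word X Ω)} (ha : a ∈ rbDegreeLE k X Ω n) :
    bracketTailOp α v a ∈ rbDegreeLE k X Ω (1 + n + v.totalDegree) :=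
  map_mem_of_mem_rbDegreeLE _ _ (fun a ha hn => by
    rw [bracketTailOp_single]
    exact single_mem_rbDegreeLE (hv a ha) (by rw [Word.totalDegree]; omega)) ha

theorem bracketOp_mem_rbDegreeLE (α : Ω) {n : ℕ} {a : MonoidAlgebra k (Word X Ω)}
    (ha : a ∈ rbDegreeLE k X Ω n) : bracketOp k X α a ∈ rbDegreeLE k X Ω (1 + n) :=
  bracketTailOp_mem_rbDegreeLE (v := .nil) α (fun _ h => h.bracket α) ha

/-- One induction yields both closure of k𝔛_∞ under the product and the degree bound, since each
follows the recursion of `star`. -/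
theorem star_mem_rbDegreeLE (a b : Word X Ω) (ha : a.IsRB) (hb : b.IsRB) :
    star lam a b ∈ rbDegreeLE k X Ω (a.totalDegree + b.totalDegree) := by
  induction hn : a.totalDegree + b.totalDegree using Nat.strong_induction_on
    generalizing a b with
  | _ n ih =>
  subst hn
  -- Both admissible tails, empty or starting with a letter, are treated together; the condition on
  -- `v` is that any bracket may stand before it.
  have overlap : ∀ (α β : Ω) (p q v : Word X Ω),
      (∀ (δ : Ω) (r : Word X Ω), r.IsRB → (Word.consBracket δ r v).IsRB) → p.IsRB → q.IsRB →
      (∀ m < (Word.consBracket α p .nil).totalDegree + (Word.consBracket β q v).totalDegree,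
        ∀ a b : Word X Ω, a.IsRB → b.IsRB → a.totalDegree + b.totalDegree = m →
          star lam a b ∈ rbDegreeLE k X Ω m) →
      star lam (.consBracket α p .nil) (.consBracket β q v) ∈ rbDegreeLE k X Ω
        ((Word.consBracket α p .nil).totalDegree + (Word.consBracket β q v).totalDegree) := by
    intro α β p q v hv hp hq ih
    simp only [Word.totalDegree] at ih ⊢
    rw [star]
    refine Submodule.add_mem _ (Submodule.add_mem _ ?_ ?_) (Submodule.smul_mem _ _ ?_)
    · exact rbDegreeLE_mono (by simp only [Word.totalDegree]; omega)
        (bracketTailOp_mem_rbDegreeLE α (hv α)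
          (ih _ (by simp only [Word.totalDegree]; omega) p _ hp (hq.bracket β) rfl))
    · exact rbDegreeLE_mono (by simp only [Word.totalDegree]; omega)
        (bracketTailOp_mem_rbDegreeLE β (hv β)
          (ih _ (by simp only [Word.totalDegree]; omega) _ q (hp.bracket α) hq rfl))
    -- The weight term has one bracket fewer, so its degree bound is strictly smaller: the product
    -- is filtered rather than graded.
    · exact rbDegreeLE_mono (by omega)
        (bracketTailOp_mem_rbDegreeLE α (hv α) (ih _ (by omega) p q hp hq rfl))
  cases ha with
  | nil =>
    rw [star]
    exact single_mem_rbDegreeLE hb (by omega)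
  | @consVar x a ha =>
    simp only [Word.totalDegree] at ih ⊢
    rw [star, add_assoc]
    exact consVarOp_mem_rbDegreeLE x (ih _ (by omega) a b ha hb rfl)
  | @consBracket α x p a hp ha =>
    simp only [Word.totalDegree] at ih ⊢
    rw [star]
    refine map_mem_of_mem_rbDegreeLE (consBracketOp α p ∘ₗ consVarOp x) _ (fun c hc hn => ?_)
      (ih _ (by omega) a b ha hb rfl)
    rw [LinearMap.comp_apply, consVarOp_single, consBracketOp_single]
    exact single_mem_rbDegreeLE (hp.consBracket α x hc)
      (by simp only [Word.totalDegree]; omega)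
  | @bracket α p hp =>
    cases hb with
    | nil =>
      rw [star]
      exact single_mem_rbDegreeLE (hp.bracket α) (by omega)
    | consVar x hb =>
      rw [star]
      exact single_mem_rbDegreeLE (hp.consBracket α x hb)
        (by simp only [Word.totalDegree]; omega)
    | @bracket β q hq => exact overlap α β p q _ (fun δ _ h => h.bracket δ) hp hq ih
    | @consBracket β x q b hq hb =>
      exact overlap α β p q _ (fun δ _ h => h.consBracket δ x hb) hp hq ih

theorem mulL_mem_rbDegreeLE {m n : ℕ} {a b : MonoidAlgebra k (Word X Ω)}
    (ha : a ∈ rbDegreeLE k X Ω m) (hb : b ∈ rbDegreeLE k X Ω n) :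
    mulL lam a b ∈ rbDegreeLE k X Ω (m + n) := by
  refine map_mem_of_mem_rbDegreeLE ((mulL lam).flip b) _ (fun a ha hm => ?_) ha
  refine map_mem_of_mem_rbDegreeLE (mulL lam (MonoidAlgebra.single a 1)) _ (fun b hb hn => ?_) hb
  rw [mulL_single]
  exact rbDegreeLE_mono (by omega) (star_mem_rbDegreeLE lam a b ha hb)

theorem mulL_assoc_of_mem_rbDegreeLE {m n : ℕ} {a b : MonoidAlgebra k (Word X Ω)}
    (ha : a ∈ rbDegreeLE k X Ω m) (hb : b ∈ rbDegreeLE k X Ω n) (c : MonoidAlgebra k (Word X Ω)) :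
    mulL lam (mulL lam a b) c = mulL lam a (mulL lam b c) := by
  -- Phrasing the equation as membership in ⊥ lets the extension from words to linear combinations
  -- be applied in each variable.
  rw [← sub_eq_zero, ← Submodule.mem_bot k]
  refine map_mem_of_mem_rbDegreeLE
    ((mulL lam).flip c ∘ₗ (mulL lam).flip b - (mulL lam).flip (mulL lam b c)) ⊥
    (fun a ha _ => ?_) ha
  refine map_mem_of_mem_rbDegreeLE ((mulL lam).flip c ∘ₗ mulL lam (MonoidAlgebra.single a 1) -
    mulL lam (MonoidAlgebra.single a 1) ∘ₗ (mulL lam).flip c) ⊥ (fun b hb _ => ?_) hb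
  refine mem_of_forall_single (mulL lam
    (mulL lam (MonoidAlgebra.single a 1) (MonoidAlgebra.single b 1)) -
      mulL lam (MonoidAlgebra.single a 1) ∘ₗ mulL lam (MonoidAlgebra.single b 1)) ⊥
    (fun c => ?_) c
  rw [Submodule.mem_bot, LinearMap.sub_apply, sub_eq_zero]
  exact mulL_assoc_single lam a b c ha hb

/-! ### The normal form map. -/

/-- The normal form of a bracketed word. -/
def normalForm : Word X Ω → MonoidAlgebra k (Word X Ω)
  | .nil => MonoidAlgebra.single .nil 1
  | .consVar x a => consVarOp x (normalForm a)
  | .consBracket α u a => mulL lam (bracketOp k X α (normalForm u)) (normalForm a)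

theorem normalForm_mem_rbDegreeLE (a : Word X Ω) :
    normalForm lam a ∈ rbDegreeLE k X Ω a.totalDegree := by
  induction a with
  | nil => exact single_mem_rbDegreeLE .nil le_rfl
  | consVar x a ih => exact consVarOp_mem_rbDegreeLE x ih
  | consBracket α u a ihu iha =>
    exact mulL_mem_rbDegreeLE lam
      (bracketOp_mem_rbDegreeLE α ihu) iha

/-- This is where associativity is used: a word is evaluated from the right, and a leading bracket
must be moved out of the product. -/
theorem normalForm_mul (a b : Word X Ω) :
    normalForm lam (a * b) = mulL lam (normalForm lam a) (normalForm lam b) := by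
  induction a with
  | nil =>
    rw [normalForm, mulL_nil_left]
    rfl
  | consVar x a ih =>
    change normalForm lam (.consVar x (a * b)) = _
    rw [normalForm, ih, normalForm, mulL_consVarOp]
  | consBracket α u a _ ih =>
    change normalForm lam (.consBracket α u (a * b)) = _
    rw [normalForm, ih, normalForm, mulL_assoc_of_mem_rbDegreeLE lam
      (bracketOp_mem_rbDegreeLE α (normalForm_mem_rbDegreeLE lam u)) (normalForm_mem_rbDegreeLE lam a)]

theorem normalForm_bracket (α : Ω) (u : Word X Ω) :
    normalForm lam (Word.bracket α u) = bracketOp k X α (normalForm lam u) := by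
  rw [Word.bracket, normalForm, normalForm, mulL_nil_right]

theorem normalForm_of_isRB {a : Word X Ω} (ha : a.IsRB) :
    normalForm lam a = MonoidAlgebra.single a 1 := by
  induction ha with
  | nil => rw [normalForm]
  | consVar x _ ih => rw [normalForm, ih, consVarOp_single]
  | bracket α _ ih => rw [normalForm, ih, normalForm, mulL_nil_right, bracketOp_single]
  | consBracket α x _ _ ih₁ ih₂ =>
    rw [normalForm, ih₁, normalForm, ih₂, consVarOp_single, mulL_bracketOp_consVar,
      bracketTailOp_single]

/-- The linear extension of `normalForm`. -/
def normalFormL : MonoidAlgebra k (Word X Ω) →ₗ[k] MonoidAlgebra k (Word X Ω) :=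
  (MonoidAlgebra.basis (Word X Ω) k).constr k (normalForm lam)

theorem normalFormL_single (a : Word X Ω) :
    normalFormL lam (MonoidAlgebra.single a 1) = normalForm lam a := by
  rw [normalFormL, ← MonoidAlgebra.basis_apply, Module.Basis.constr_basis]

theorem normalFormL_mul (a b : MonoidAlgebra k (Word X Ω)) :
    normalFormL lam (a * b) = mulL lam (normalFormL lam a) (normalFormL lam b) := by
  suffices h : (LinearMap.mul k (MonoidAlgebra k (Word X Ω))).compr₂ (normalFormL lam) =
      (mulL lam).compl₁₂ (normalFormL lam) (normalFormL lam) by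
    exact LinearMap.congr_fun (LinearMap.congr_fun h a) b
  refine linearMap_ext fun a => linearMap_ext fun b => ?_
  simp only [LinearMap.compr₂_apply, LinearMap.mul_apply', LinearMap.compl₁₂_apply,
    MonoidAlgebra.single_mul_single, mul_one, normalFormL_single, normalForm_mul]

theorem normalFormL_bracketOp (α : Ω) (a : MonoidAlgebra k (Word X Ω)) :
    normalFormL lam (bracketOp k X α a) = bracketOp k X α (normalFormL lam a) := by
  suffices h : normalFormL lam ∘ₗ bracketOp k X α = bracketOp k X α ∘ₗ normalFormL lam by
    exact LinearMap.congr_fun h a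
  refine linearMap_ext fun a => ?_
  rw [LinearMap.comp_apply, LinearMap.comp_apply, bracketOp_single, normalFormL_single,
    normalFormL_single, ← normalForm_bracket, Word.bracket]

theorem normalFormL_mem_rbDegreeLE {n : ℕ} {a : MonoidAlgebra k (Word X Ω)}
    (ha : a ∈ MonoidAlgebra.supported k k (Word.wordsOfDegreeLE X Ω n)) :
    normalFormL lam a ∈ rbDegreeLE k X Ω n :=
  mem_of_mem_supported _ _ (fun a ha => by
    rw [normalFormL_single]
    exact rbDegreeLE_mono ha (normalForm_mem_rbDegreeLE lam a)) ha

theorem normalFormL_mem_rbSpan (a : MonoidAlgebra k (Word X Ω)) :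
    normalFormL lam a ∈ rbSpan k X Ω :=
  mem_of_forall_single _ _ (fun a => by
    rw [normalFormL_single]
    exact rbDegreeLE_le_rbSpan _ (normalForm_mem_rbDegreeLE lam a)) a

theorem normalFormL_of_mem_rbSpan {a : MonoidAlgebra k (Word X Ω)} (ha : a ∈ rbSpan k X Ω) :
    normalFormL lam a = a := by
  rw [← sub_eq_zero, ← Submodule.mem_bot k]
  refine mem_of_mem_supported (normalFormL lam - LinearMap.id) ⊥ (fun a ha => ?_) ha
  rw [Submodule.mem_bot, LinearMap.sub_apply, normalFormL_single, sub_eq_zero]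
  exact normalForm_of_isRB lam (Word.mem_rbWords_iff.1 ha)

theorem rbIdeal_le {I : Submodule k (MonoidAlgebra k (Word X Ω))}
    (hI : IsOperatedIdeal (bracketOp k X) I) (h : rbRelations k X lam ⊆ I) :
    rbIdeal k X lam ≤ I :=
  sInf_le ⟨hI, h⟩

/-- The kernel is an operated ideal, and it contains the relations because `mulL` satisfies the
Rota-Baxter equation. -/
theorem normalFormL_eq_zero_of_mem_rbIdeal {a : MonoidAlgebra k (Word X Ω)}
    (ha : a ∈ rbIdeal k X lam) : normalFormL lam a = 0 := by
  refine rbIdeal_le lam (I := LinearMap.ker (normalFormL lam)) ⟨?_, ?_, ?_⟩ ?_ ha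
  · intro a x hx
    rw [LinearMap.mem_ker] at hx ⊢
    rw [normalFormL_mul, hx, map_zero]
  · intro a x hx
    rw [LinearMap.mem_ker] at hx ⊢
    rw [normalFormL_mul, hx, map_zero, LinearMap.zero_apply]
  · intro ω x hx
    rw [LinearMap.mem_ker] at hx ⊢
    rw [normalFormL_bracketOp, hx, map_zero]
  · rintro _ ⟨α, β, x, y, rfl⟩
    simp only [SetLike.mem_coe, LinearMap.mem_ker, map_sub, map_smul, MonoidAlgebra.of_apply,
      normalFormL_single, normalForm_mul, normalForm_bracket, mulL_bracketOp_bracketOp]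
    abel

/-! ### Congruence modulo Id(S) and the direct sum decomposition. -/

/-- The matching Rota-Baxter equation holds modulo `Id(S)`. -/
theorem rotaBaxter_sub_mem_rbIdeal (α β : Ω) (a b : MonoidAlgebra k (Word X Ω)) :
    bracketOp k X α a * bracketOp k X β b - bracketOp k X α (a * bracketOp k X β b) -
      bracketOp k X β (bracketOp k X α a * b) - lam β • bracketOp k X α (a * b) ∈
        rbIdeal k X lam := by
  let m := LinearMap.mul k (MonoidAlgebra k (Word X Ω))
  let F := m.compl₁₂ (bracketOp k X α) (bracketOp k X β) -
    (m.compl₁₂ LinearMap.id (bracketOp k X β)).compr₂ (bracketOp k X α) -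
    (m.compl₁₂ (bracketOp k X α) LinearMap.id).compr₂ (bracketOp k X β) -
    lam β • m.compr₂ (bracketOp k X α)
  refine mem_of_forall_single (F.flip b) _ (fun a => ?_) a
  refine mem_of_forall_single (F (MonoidAlgebra.single a 1)) _ (fun b => ?_) b
  have h : rbRelations k X lam ⊆ rbIdeal k X lam :=
    fun x hx => Submodule.mem_sInf.2 fun I hI => hI.2 hx
  refine h ⟨α, β, a, b, ?_⟩
  simp only [F, m, LinearMap.sub_apply, LinearMap.smul_apply, LinearMap.compl₁₂_apply,
    LinearMap.compr₂_apply, LinearMap.mul_apply', LinearMap.id_apply, bracketOp_single,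
    MonoidAlgebra.single_mul_single, mul_one, MonoidAlgebra.of_apply, Word.bracket]

theorem isOperatedIdeal_rbIdeal : IsOperatedIdeal (bracketOp k X) (rbIdeal k X lam) :=
  isOperatedIdeal_operatedIdealSpan _ _

theorem consVarOp_eq_mul (x : X) (a : MonoidAlgebra k (Word X Ω)) :
    consVarOp x a = MonoidAlgebra.single (Word.var x) 1 * a := by
  suffices h : consVarOp x = LinearMap.mulLeft k (MonoidAlgebra.single (Word.var x) (1 : k)) by
    rw [h, LinearMap.mulLeft_apply]
  refine linearMap_ext fun (a : Word X Ω) => ?_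
  rw [consVarOp_single, LinearMap.mulLeft_apply, MonoidAlgebra.single_mul_single, mul_one]
  rfl

theorem consBracketOp_eq_mul (α : Ω) (p : Word X Ω) (a : MonoidAlgebra k (Word X Ω)) :
    consBracketOp α p a = MonoidAlgebra.single (Word.bracket α p) 1 * a := by
  suffices h : consBracketOp α p =
      LinearMap.mulLeft k (MonoidAlgebra.single (Word.bracket α p) (1 : k)) by
    rw [h, LinearMap.mulLeft_apply]
  refine linearMap_ext fun a => ?_
  rw [consBracketOp_single, LinearMap.mulLeft_apply, MonoidAlgebra.single_mul_single, mul_one]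
  rfl

theorem bracketTailOp_eq_mul (α : Ω) (v : Word X Ω) (a : MonoidAlgebra k (Word X Ω)) :
    bracketTailOp α v a = bracketOp k X α a * MonoidAlgebra.single v 1 := by
  suffices h : bracketTailOp α v =
      LinearMap.mulRight k (MonoidAlgebra.single v (1 : k)) ∘ₗ bracketOp k X α by
    rw [h, LinearMap.comp_apply, LinearMap.mulRight_apply]
  refine linearMap_ext fun a => ?_
  rw [bracketTailOp_single, LinearMap.comp_apply, bracketOp_single, LinearMap.mulRight_apply,
    MonoidAlgebra.single_mul_single, mul_one]
  rfl

/-- Each clause of `star` is a concatenation or one application of a relation, so the claim holds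
for all words, adjacent brackets or not. -/
theorem star_sub_mem_rbIdeal (a b : Word X Ω) :
    MonoidAlgebra.single (a * b) 1 - star lam a b ∈ rbIdeal k X lam := by
  have hI := isOperatedIdeal_rbIdeal (X := X) lam
  have hvar : ∀ x (a b : Word X Ω), MonoidAlgebra.single (a * b) 1 - star lam a b ∈
      rbIdeal k X lam → MonoidAlgebra.single (Word.consVar x a * b) 1 -
        consVarOp x (star lam a b) ∈ rbIdeal k X lam := by
    intro x a b h
    have := hI.mul_left (MonoidAlgebra.single (Word.var x) 1) _ h
    rw [← consVarOp_eq_mul, map_sub, consVarOp_single] at this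
    exact this
  induction a, b using star.induct with
  | case1 b =>
    rw [star, show (Word.nil : Word X Ω) * b = b from rfl, sub_self]
    exact zero_mem _
  | case2 x a b ih => rw [star]; exact hvar x a b ih
  | case3 α p x a b ih =>
    have := hI.mul_left (MonoidAlgebra.single (Word.bracket α p) 1) _ (hvar x a b ih)
    rw [← consBracketOp_eq_mul, map_sub, consBracketOp_single] at this
    rw [star]
    exact this
  | case4 α p β q a b ih =>
    have := hI.mul_left (MonoidAlgebra.single (Word.bracket α p) 1) _ ih
    rw [← consBracketOp_eq_mul, map_sub, consBracketOp_single] at this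
    rw [star]
    exact this
  | case5 α p =>
    rw [star, show Word.consBracket α p Word.nil * Word.nil =
      Word.consBracket α p Word.nil from rfl,
      sub_self]
    exact zero_mem _
  | case6 α p x b =>
    rw [star, show Word.consBracket α p Word.nil * Word.consVar x b =
      Word.consBracket α p (Word.consVar x b) from rfl, sub_self]
    exact zero_mem _
  | case7 α p β q v ih₁ ih₂ ih₃ =>
    rw [star]
    simp only [bracketTailOp_eq_mul]
    have h := rotaBaxter_sub_mem_rbIdeal lam α β (MonoidAlgebra.single p 1)
      (MonoidAlgebra.single q (1 : k))
    have h₁ := hI.map_op α _ ih₁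
    have h₂ := hI.map_op β _ ih₂
    have h₃ := Submodule.smul_mem _ (lam β) (hI.map_op α _ ih₃)
    -- The relation for ⌊p⌋⌊q⌋ leaves concatenations inside brackets; the three bracketed induction
    -- hypotheses replace them by products, and the tail `v` is multiplied on at the end.
    have := hI.mul_right (MonoidAlgebra.single v 1) _ (add_mem (add_mem (add_mem h h₁) h₂) h₃)
    convert this using 1
    have hw : MonoidAlgebra.single (Word.consBracket α p Word.nil * Word.consBracket β q v) 1 =
        bracketOp k X α (MonoidAlgebra.single p 1) * bracketOp k X β (MonoidAlgebra.single q 1) *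
          MonoidAlgebra.single v 1 := by
      simp only [bracketOp_single, MonoidAlgebra.single_mul_single, mul_one]
      rfl
    rw [hw]
    simp only [bracketOp_single, MonoidAlgebra.single_mul_single, mul_one, map_sub, add_mul,
      sub_mul, smul_sub, smul_mul_assoc]
    abel

theorem mul_sub_mulL_mem_rbIdeal (a b : MonoidAlgebra k (Word X Ω)) :
    a * b - mulL lam a b ∈ rbIdeal k X lam := by
  let F := LinearMap.mul k (MonoidAlgebra k (Word X Ω)) - mulL lam
  refine mem_of_forall_single (F.flip b) _ (fun a => ?_) a
  refine mem_of_forall_single (F (MonoidAlgebra.single a 1)) _ (fun b => ?_) b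
  simp only [F, LinearMap.sub_apply, LinearMap.mul_apply', mulL_single,
    MonoidAlgebra.single_mul_single, mul_one]
  exact star_sub_mem_rbIdeal lam a b

theorem single_sub_normalForm_mem_rbIdeal (a : Word X Ω) :
    MonoidAlgebra.single a 1 - normalForm lam a ∈ rbIdeal k X lam := by
  have hI := isOperatedIdeal_rbIdeal (X := X) lam
  induction a with
  | nil => rw [normalForm, sub_self]; exact zero_mem _
  | consVar x a ih =>
    have := hI.mul_left (MonoidAlgebra.single (Word.var x) 1) _ ih
    rw [← consVarOp_eq_mul, map_sub, consVarOp_single] at this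
    exact this
  | consBracket α u a ihu iha =>
    have h₁ := hI.mul_right (MonoidAlgebra.single a 1) _ (hI.map_op α _ ihu)
    have h₂ := hI.mul_left (bracketOp k X α (normalForm lam u)) _ iha
    have h₃ := mul_sub_mulL_mem_rbIdeal lam (bracketOp k X α (normalForm lam u))
      (normalForm lam a)
    have hw : MonoidAlgebra.single (Word.consBracket α u a) (1 : k) =
        bracketOp k X α (MonoidAlgebra.single u 1) * MonoidAlgebra.single a 1 := by
      rw [← bracketTailOp_eq_mul, bracketTailOp_single]
    rw [normalForm, hw]
    convert add_mem (add_mem h₁ h₂) h₃ using 1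
    rw [map_sub, sub_mul, mul_sub]
    abel

theorem sub_normalFormL_mem_rbIdeal (a : MonoidAlgebra k (Word X Ω)) :
    a - normalFormL lam a ∈ rbIdeal k X lam :=
  mem_of_forall_single (LinearMap.id - normalFormL lam) _ (fun a => by
    rw [LinearMap.sub_apply, normalFormL_single]
    exact single_sub_normalForm_mem_rbIdeal lam a) a

/-- An element of the intersection equals its normal form, which is zero; any element is its normal
form plus a remainder in Id(S). -/
theorem isCompl_rbSpan_rbIdeal : IsCompl (rbSpan k X Ω) (rbIdeal k X lam) := by
  refine ⟨Submodule.disjoint_def.2 fun a ha hI => ?_, Submodule.codisjoint_iff_exists_add_eq.2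
    fun a => ⟨_, _, normalFormL_mem_rbSpan lam a, sub_normalFormL_mem_rbIdeal lam a, ?_⟩⟩
  · rw [← normalFormL_of_mem_rbSpan lam ha, normalFormL_eq_zero_of_mem_rbIdeal lam hI]
  · abel

end NormalForm

/-! ### The structure on k𝔛_∞ and its filtration. -/

namespace FreeMRB

variable {k : Type u} {X : Type v} {Ω : Type w} [CommRing k] {lam : Ω → k}
  (hc : IsCompl (rbSpan k X Ω) (rbIdeal k X lam))

theorem incl_injective : Function.Injective (incl hc) := Subtype.val_injective

/-- The abstract projection is thereby computed: an element and its normal form are congruent modulo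
Id(S), and the latter already lies in k𝔛_∞. -/
theorem incl_proj (a : MonoidAlgebra k (Word X Ω)) : incl hc (proj hc a) = normalFormL lam a := by
  have h : proj hc a = proj hc (normalFormL lam a) := by
    rw [← sub_eq_zero, ← map_sub, proj_eq_zero_iff]
    exact sub_normalFormL_mem_rbIdeal lam a
  rw [h]
  exact congrArg (incl hc) (proj_incl hc ⟨_, normalFormL_mem_rbSpan lam a⟩)

theorem incl_op (ω : Ω) (a : FreeMRB hc) :
    incl hc (op hc ω a) = bracketOp k X ω (incl hc a) := rfl

theorem proj_bracketOp (ω : Ω) (a : MonoidAlgebra k (Word X Ω)) :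
    proj hc (bracketOp k X ω a) = op hc ω (proj hc a) := by
  apply incl_injective hc
  rw [incl_op, incl_proj, incl_proj, normalFormL_bracketOp]

theorem isMatchingRotaBaxter : IsMatchingRotaBaxter lam (op hc) := by
  intro α β x y
  have h := rotaBaxter_sub_mem_rbIdeal lam α β (incl hc x) (incl hc y)
  rw [← proj_eq_zero_iff hc] at h
  simp only [map_sub, map_smul, proj_bracketOp, ← incl_op, ← mul_def] at h
  rw [sub_sub, sub_sub, sub_eq_zero, ← add_assoc] at h
  exact h

theorem mem_filtration_iff {n : ℕ} {a : FreeMRB hc} :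
    a ∈ filtration hc n ↔ incl hc a ∈ rbDegreeLE k X Ω n := Iff.rfl

theorem phi_mem_filtration {n : ℕ} {a : MonoidAlgebra k (Word X Ω)}
    (ha : a ∈ MonoidAlgebra.supported k k (Word.wordsOfDegreeLE X Ω n)) :
    phi hc a ∈ filtration hc n := by
  rw [mem_filtration_iff]
  exact (incl_proj hc a).symm ▸ normalFormL_mem_rbDegreeLE lam ha

theorem isOperatedFilteredAlgebra : IsOperatedFilteredAlgebra (op hc) (filtration hc) where
  mono _ _ h _ ha := rbDegreeLE_mono h ha
  exhaustive a := by
    -- Passing to normal forms of arbitrary elements allows induction in k𝔐; an element of k𝔛_∞ is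
    -- its own normal form.
    suffices h : ∀ x : MonoidAlgebra k (Word X Ω), ∃ n, normalFormL lam x ∈ rbDegreeLE k X Ω n by
      obtain ⟨n, hn⟩ := h (incl hc a)
      rw [← incl_proj hc, proj_incl] at hn
      exact ⟨n, hn⟩
    intro x
    induction x using MonoidAlgebra.induction_on with
    | of a =>
      refine ⟨a.totalDegree, ?_⟩
      rw [MonoidAlgebra.of_apply, normalFormL_single]
      exact normalForm_mem_rbDegreeLE lam a
    | add x y hx hy =>
      obtain ⟨m, hm⟩ := hx
      obtain ⟨n, hn⟩ := hy
      refine ⟨max m n, ?_⟩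
      rw [map_add]
      exact add_mem (rbDegreeLE_mono (le_max_left _ _) hm) (rbDegreeLE_mono (le_max_right _ _) hn)
    | smul c x hx =>
      obtain ⟨n, hn⟩ := hx
      exact ⟨n, by rw [map_smul]; exact Submodule.smul_mem _ c hn⟩
  one_mem := single_mem_rbDegreeLE .nil le_rfl
  mul_mem p q a ha b hb := by
    rw [mem_filtration_iff] at ha hb ⊢
    -- Both factors are their own normal forms, so ⋄ is `mulL` on k𝔛_∞.
    rw [mul_def, incl_proj, normalFormL_mul,
      normalFormL_of_mem_rbSpan lam (rbDegreeLE_le_rbSpan p ha),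
      normalFormL_of_mem_rbSpan lam (rbDegreeLE_le_rbSpan q hb)]
    exact mulL_mem_rbDegreeLE lam ha hb
  op_mem ω p a ha := by
    rw [mem_filtration_iff] at ha ⊢
    rw [incl_op, add_comm]
    exact bracketOp_mem_rbDegreeLE ω ha

/-! ### The universal property. -/

section Lift

variable {B : Type t} [Ring B] [Algebra k B] (Q : Ω → B →ₗ[k] B) (f : X → B)

/-- The value of a bracketed word in an operated algebra. -/
def evalWord : Word X Ω → B
  | .nil => 1
  | .consVar x a => f x * evalWord a
  | .consBracket ω u a => Q ω (evalWord u) * evalWord a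

theorem evalWord_mul (a b : Word X Ω) :
    evalWord Q f (a * b) = evalWord Q f a * evalWord Q f b := by
  induction a with
  | nil => rw [evalWord, one_mul]; rfl
  | consVar x a ih =>
    change evalWord Q f (.consVar x (a * b)) = _
    rw [evalWord, ih, evalWord, mul_assoc]
  | consBracket ω u a _ ih =>
    change evalWord Q f (.consBracket ω u (a * b)) = _
    rw [evalWord, ih, evalWord, mul_assoc]

/-- `k𝔐(X, Ω)` is the free operated algebra: the homomorphism that extends `f`. -/
def evalHom : MonoidAlgebra k (Word X Ω) →ₐ[k] B :=
  MonoidAlgebra.lift k B (Word X Ω)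
    { toFun := evalWord Q f
      map_one' := rfl
      map_mul' := evalWord_mul Q f }

theorem evalHom_single (a : Word X Ω) :
    evalHom Q f (MonoidAlgebra.single a (1 : k)) = evalWord Q f a := by
  rw [evalHom, MonoidAlgebra.lift_single, one_smul]
  rfl

theorem evalHom_bracketOp (ω : Ω) (a : MonoidAlgebra k (Word X Ω)) :
    evalHom Q f (bracketOp k X ω a) = Q ω (evalHom Q f a) := by
  suffices h : (evalHom Q f).toLinearMap ∘ₗ bracketOp k X ω =
      Q ω ∘ₗ (evalHom Q f).toLinearMap by exact LinearMap.congr_fun h a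
  refine linearMap_ext fun a => ?_
  simp only [LinearMap.comp_apply, AlgHom.toLinearMap_apply, bracketOp_single, evalHom_single]
  rw [evalWord, evalWord, mul_one]

theorem evalHom_eq_zero_of_mem_rbIdeal (hQ : IsMatchingRotaBaxter lam Q)
    {a : MonoidAlgebra k (Word X Ω)} (ha : a ∈ rbIdeal k X lam) : evalHom Q f a = 0 := by
  refine rbIdeal_le lam (I := LinearMap.ker (evalHom Q f).toLinearMap) ⟨?_, ?_, ?_⟩ ?_ ha
  · intro a x hx
    rw [LinearMap.mem_ker, AlgHom.toLinearMap_apply] at hx ⊢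
    rw [map_mul, hx, mul_zero]
  · intro a x hx
    rw [LinearMap.mem_ker, AlgHom.toLinearMap_apply] at hx ⊢
    rw [map_mul, hx, zero_mul]
  · intro ω x hx
    rw [LinearMap.mem_ker, AlgHom.toLinearMap_apply] at hx ⊢
    rw [evalHom_bracketOp, hx, map_zero]
  · rintro _ ⟨α, β, x, y, rfl⟩
    have hb : ∀ ω (u : Word X Ω), evalWord Q f (Word.bracket ω u) = Q ω (evalWord Q f u) :=
      fun ω u => mul_one _
    simp only [SetLike.mem_coe, LinearMap.mem_ker, AlgHom.toLinearMap_apply, map_sub, map_smul,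
      MonoidAlgebra.of_apply, evalHom_single, evalWord_mul, hb, hQ α β]
    abel

theorem evalHom_incl_proj (hQ : IsMatchingRotaBaxter lam Q) (a : MonoidAlgebra k (Word X Ω)) :
    evalHom Q f (incl hc (proj hc a)) = evalHom Q f a := by
  rw [← sub_eq_zero, ← map_sub]
  exact evalHom_eq_zero_of_mem_rbIdeal Q f hQ (incl_proj_sub_mem hc a)

/-- The homomorphism from `k𝔛_∞` that extends `f`. -/
def lift (hQ : IsMatchingRotaBaxter lam Q) : FreeMRB hc →ₐ[k] B :=
  AlgHom.ofLinearMap ((evalHom Q f).toLinearMap ∘ₗ incl hc) (map_one (evalHom Q f))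
    (fun a b => by
      change evalHom Q f (incl hc (proj hc (incl hc a * incl hc b))) =
        evalHom Q f (incl hc a) * evalHom Q f (incl hc b)
      rw [evalHom_incl_proj hc Q f hQ, map_mul])

theorem lift_apply (hQ : IsMatchingRotaBaxter lam Q) (a : FreeMRB hc) :
    lift hc Q f hQ a = evalHom Q f (incl hc a) := rfl

/-- Uniqueness is checked on k𝔐: g ∘ φ respects products and operators, so its values on words are
forced by those on letters. As φ is surjective, this determines g. -/
theorem hom_phi_single (g : FreeMRB hc →ₐ[k] B) (hg : ∀ ω a, g (op hc ω a) = Q ω (g a))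
    (hgf : ∀ x, g (ofVar hc x) = f x) (a : Word X Ω) :
    g (phi hc (MonoidAlgebra.single a 1)) = evalWord Q f a := by
  induction a with
  | nil =>
    change g (phi hc 1) = 1
    rw [map_one, map_one]
  | consVar x a ih =>
    have hx : phi hc (MonoidAlgebra.single (Word.var x) 1) = ofVar hc x :=
      proj_incl hc (ofVar hc x)
    rw [← consVarOp_single, consVarOp_eq_mul, map_mul, map_mul, ih, hx, hgf, evalWord]
  | consBracket ω u a ihu iha =>
    have hb : ∀ b, phi hc (bracketOp k X ω b) = op hc ω (phi hc b) := proj_bracketOp hc ω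
    rw [← bracketTailOp_single, bracketTailOp_eq_mul, map_mul, map_mul, iha, hb, hg, ihu, evalWord]

end Lift

theorem isFreeMatchingRotaBaxter :
    IsFreeMatchingRotaBaxter.{u, v, w, max u v w, t} lam (op hc) (ofVar hc) := by
  refine ⟨isMatchingRotaBaxter hc, fun B _ _ Q hQ f => ⟨lift hc Q f hQ, ⟨?_, ?_⟩, ?_⟩⟩
  · intro ω a
    rw [lift_apply, lift_apply, incl_op, evalHom_bracketOp]
  · intro x
    exact (evalHom_single Q f (Word.var x)).trans (mul_one (f x))
  · rintro g ⟨hg, hgf⟩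
    have h : g.toLinearMap ∘ₗ (phi hc).toLinearMap = (evalHom Q f).toLinearMap :=
      linearMap_ext fun a => by
        simp only [LinearMap.comp_apply, AlgHom.toLinearMap_apply, evalHom_single]
        exact hom_phi_single hc Q f g hg hgf a
    exact AlgHom.ext fun a => (congrArg g (proj_incl hc a).symm).trans
      (LinearMap.congr_fun h (incl hc a))

end FreeMRB

end MatchingRB

end

theorem mainTheorem8 {k : Type u} {X : Type v} {Ω : Type w} [CommRing k] [Nonempty Ω]
    (lam : Ω → k) :
    -- the decomposition that defines the projection `φ` and the algebra structure on `k𝔛_∞`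
    ∃ hc : IsCompl (MatchingRB.rbSpan k X Ω) (MatchingRB.rbIdeal k X lam),
      MatchingRB.IsFreeMatchingRotaBaxter.{u, v, w, max u v w, t} lam
        (MatchingRB.FreeMRB.op hc) (MatchingRB.FreeMRB.ofVar hc) ∧
      MatchingRB.IsOperatedFilteredAlgebra
        (MatchingRB.FreeMRB.op hc) (MatchingRB.FreeMRB.filtration hc) ∧
      (∀ (ω : Ω) (a : MonoidAlgebra k (MatchingRB.Word X Ω)),
        MatchingRB.FreeMRB.phi hc (MatchingRB.bracketOp k X ω a) =
          MatchingRB.FreeMRB.op hc ω (MatchingRB.FreeMRB.phi hc a)) ∧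
      ∀ (n : ℕ) (a : MonoidAlgebra k (MatchingRB.Word X Ω)),
        a ∈ MonoidAlgebra.supported k k (MatchingRB.Word.wordsOfDegreeLE X Ω n) →
          MatchingRB.FreeMRB.phi hc a ∈ MatchingRB.FreeMRB.filtration hc n := by
  have hc := MatchingRB.isCompl_rbSpan_rbIdeal (X := X) lam
  exact ⟨hc, MatchingRB.FreeMRB.isFreeMatchingRotaBaxter hc,
    MatchingRB.FreeMRB.isOperatedFilteredAlgebra hc, MatchingRB.FreeMRB.proj_bracketOp hc,
    fun _ _ => MatchingRB.FreeMRB.phi_mem_filtration hc⟩
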